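/- Let $K$ be a field, trivially $\mathbb Z$-graded ($K_0=K$ and $K_d=0$ for $d\neq 0$). For integers $\delta_1,\dots,\delta_m$ let $\mathbb M_m(K)(\delta_1,\dots,\delta_m)$ be the matrix algebra $\mathbb M_m(K)$ with the $\mathbb Z$-grading in which $(r_{ij})$ has degree $d$ if $r_{ij}\in K_{-\delta_i+d+\delta_j}$ for all $i,j$. A list in which $\delta_1$ occurs $d_1$ times, then $\delta_2$ occurs $d_2$ times, and so on, is written $d_1(\delta_1),d_2(\delta_2),\dots$. For a directed graph $E$ (with arbitrary sets $E^0$ of vertices and $E^1$ of edges, and source and range maps $\mathbf s,\mathbf r$) the Leavitt path algebra $L_K(E)$ is the (not necessarily unital) $K$-algebra generated by $E^0\cup E^1\cup\{e^*\mid e\in E^1\}$ subject to the following relations, for all vertices $v,w$ and edges $e,f$: $vw=0$ if $v\ne w$ and $vv=v$; $\mathbf s(e)e=e\mathbf r(e)=e$; $\mathbf r(e)e^*=e^*\mathbf s(e)=e^*$; $e^*f=0$ if $e\neq f$ and $e^*e=\mathbf r(e)$; and $v=\sum_{e\in\mathbf s^{-1}(v)}ee^*$ for each vertex $v$ which emits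 a finite nonzero number of edges. It is $\mathbb Z$-graded: its component of degree $d$ is the $K$-span of the elements $pq^*$ for paths $p,q$ with $|p|-|q|=d$. A sink is a vertex which emits no edges; a graph is finite if $E^0$ and $E^1$ are finite; it is acyclic if it has no cycles, i.e. no closed paths of positive length whose edges have pairwise different sources. Let $n$ be a positive integer, let $\gamma_1,\dots,\gamma_n$ be arbitrary integers, and let $R=\mathbb M_n(K)(\gamma_1,\dots,\gamma_n)$. Subtract the smallest element from the list $\gamma_1,\dots,\gamma_n$ and arrange the result in nondecreasing order. If $k$ is the largest element of the new list, the new list has the form $l_0(0),l_1(1),\dots,l_k(k)$ with nonnegative integers $l_0,\dots,l_k$ ($l_0$ and $l_k$ are positive); $k$ and $l_0,\dots,l_k$ are called the representatives of the graded isomorphism class of $R$. **Proposition.** The following conditions are equivalent. 1. $R$ is graded isomorphic to $L_K(E)$ for some directed graph $E$. 2. $R$ is graded isomorphic to $L_K(E)$ for some finite acyclic directed graph $E$ with a unique sink. 3. $R$ is graded isomorphic to $\mathbb M_n(K)(0,l_1(1),l_2(2),\dots,l_k(k))$ for some nonnegative integer $k$ and positive integers $l_1,\dots,l_k$ such that $n=1+\sum_{i=1}^k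 l_i$. 4. If $k$ and $l_0,\dots,l_k$ are the representatives of the graded isomorphism class of $R$, then $l_i$ is positive for all $i=1,\dots,k$ and $l_0=1$. This holds if "graded isomorphic" means that there is a ring isomorphism which maps every homogeneous component onto the component of the same degree, and it also holds if this isomorphism is in addition required to be $K$-linear. -/

import Mathlib

universe u v w

/-! ### Directed graphs

A directed graph `E` is a quiver on its type `V` of vertices; multiple edges and loops are allowed.
`Quiver.Total V` is the type of all edges and `Quiver.Star v` the type of all edges with source `v`.
Paths are `Quiver.Path`s. -/

namespace LeavittPath

/-- A sink is a vertex which does not emit edges. -/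
def IsSink {V : Type v} [Quiver.{w} V] (a : V) : Prop :=
  IsEmpty (Quiver.Star a)

/-- A cycle is a closed path of positive length whose edges have pairwise different sources. The
list of the sources of the edges of `p` is the list of its vertices without the last entry. -/
def IsCycle {V : Type v} [Quiver.{w} V] {a : V} (p : Quiver.Path a a) : Prop :=
  0 < p.length ∧ p.vertices.dropLast.Nodup

/-- A graph is acyclic if it has no cycles. -/
def IsAcyclicGraph (V : Type v) [Quiver.{w} V] : Prop :=
  ∀ (a : V) (p : Quiver.Path a a), ¬ IsCycle p

/-- A graph is finite if it has finitely many vertices and finitely many edges. -/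
def IsFiniteGraph (V : Type v) [Quiver.{w} V] : Prop :=
  Finite V ∧ Finite (Quiver.Total V)

/-! ### The Leavitt path algebra `L_K(E)` -/

/-- The generators of the Leavitt path algebra: the vertices `a`, the edges `e`, and the ghost
edges `e*`. -/
inductive Gen (V : Type v) [Quiver.{w} V] : Type (max v w)
  | vertex (a : V) : Gen V
  | edge {a b : V} (e : a ⟶ b) : Gen V
  | ghost {a b : V} (e : a ⟶ b) : Gen V

/-- The free (associative, not necessarily unital) `K`-algebra on the generators: its basis consists
of the nonempty words in the generators. -/
abbrev FreeAlg (K : Type u) [Field K] (V : Type v) [Quiver.{w} V] : Type (max u v w) :=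
  MonoidAlgebra K (FreeSemigroup (Gen V))

/-- A generator as an element of the free algebra. -/
noncomputable def FreeAlg.gen (K : Type u) [Field K] {V : Type v} [Quiver.{w} V] (x : Gen V) :
    FreeAlg K V :=
  MonoidAlgebra.single (FreeSemigroup.of x) 1

open FreeAlg Gen in
/-- The defining relations (V), (E1), (E2), (CK1), (CK2) of the Leavitt path algebra. A vertex is
regular if the set of edges it emits is finite and nonempty. -/
inductive Rel (K : Type u) [Field K] (V : Type v) [Quiver.{w} V] : FreeAlg K V → FreeAlg K V → Prop
  | vertex_mul_vertex_ne (a b : V) (h : a ≠ b) : Rel K V (gen K (vertex a) * gen K (vertex b)) 0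
  | vertex_mul_vertex_self (a : V) :
      Rel K V (gen K (vertex a) * gen K (vertex a)) (gen K (vertex a))
  | source_mul_edge {a b : V} (e : a ⟶ b) :
      Rel K V (gen K (vertex a) * gen K (edge e)) (gen K (edge e))
  | edge_mul_range {a b : V} (e : a ⟶ b) :
      Rel K V (gen K (edge e) * gen K (vertex b)) (gen K (edge e))
  | range_mul_ghost {a b : V} (e : a ⟶ b) :
      Rel K V (gen K (vertex b) * gen K (ghost e)) (gen K (ghost e))
  | ghost_mul_source {a b : V} (e : a ⟶ b) :
      Rel K V (gen K (ghost e) * gen K (vertex a)) (gen K (ghost e))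
  | ghost_mul_edge_ne (e f : Quiver.Total V) (h : e ≠ f) :
      Rel K V (gen K (ghost e.hom) * gen K (edge f.hom)) 0
  | ghost_mul_edge_self {a b : V} (e : a ⟶ b) :
      Rel K V (gen K (ghost e) * gen K (edge e)) (gen K (vertex b))
  | sum_edge_mul_ghost (a : V) [Fintype (Quiver.Star a)] [Nonempty (Quiver.Star a)] :
      Rel K V (gen K (vertex a)) (∑ e : Quiver.Star a, gen K (edge e.2) * gen K (ghost e.2))

/-- The congruence on the free algebra generated by the defining relations. Since the algebra need
not have an identity, scalar multiples of the relations are included explicitly. -/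
noncomputable def con (K : Type u) [Field K] (V : Type v) [Quiver.{w} V] : RingCon (FreeAlg K V) :=
  ringConGen fun x y => ∃ (c : K) (a b : FreeAlg K V), Rel K V a b ∧ x = c • a ∧ y = c • b

theorem con_smul {K : Type u} [Field K] {V : Type v} [Quiver.{w} V] (c : K) {x y : FreeAlg K V}
    (h : con K V x y) : con K V (c • x) (c • y) := by
  have h' : RingConGen.Rel
      (fun x y => ∃ (c : K) (a b : FreeAlg K V), Rel K V a b ∧ x = c • a ∧ y = c • b) x y := h
  clear h
  induction h' with
  | of x y hxy =>
    obtain ⟨d, a, b, hab, rfl, rfl⟩ := hxy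
    exact RingConGen.Rel.of _ _ ⟨c * d, a, b, hab, by rw [mul_smul], by rw [mul_smul]⟩
  | refl x => exact (con K V).refl _
  | symm h ih => exact (con K V).symm ih
  | trans h₁ h₂ ih₁ ih₂ => exact (con K V).trans ih₁ ih₂
  | add h₁ h₂ ih₁ ih₂ =>
    rw [smul_add, smul_add]
    exact (con K V).add ih₁ ih₂
  | mul h₁ h₂ ih₁ ih₂ =>
    rw [← smul_mul_assoc, ← smul_mul_assoc]
    exact (con K V).mul ih₁ h₂

end LeavittPath

open LeavittPath in
/-- The Leavitt path algebra `L_K(E)` of the graph `E` with vertex type `V`: the `K`-algebra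
generated by vertices, edges and ghost edges, subject to (V), (E1), (E2), (CK1), (CK2). It has an
identity only if there are finitely many vertices, so in general it is a non-unital ring. -/
def LeavittPathAlgebra (K : Type u) [Field K] (V : Type v) [Quiver.{w} V] :
    Type (max u v w) :=
  (con K V).Quotient

namespace LeavittPathAlgebra

open LeavittPath

noncomputable instance instNonUnitalRing (K : Type u) [Field K] (V : Type v) [Quiver.{w} V] :
    NonUnitalRing (LeavittPathAlgebra K V) :=
  inferInstanceAs (NonUnitalRing (con K V).Quotient)

/-- The quotient map from the free algebra. -/
noncomputable def mk (K : Type u) [Field K] (V : Type v) [Quiver.{w} V] (x : FreeAlg K V) :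
    LeavittPathAlgebra K V :=
  (con K V).toQuotient x

noncomputable instance instSMul (K : Type u) [Field K] (V : Type v) [Quiver.{w} V] :
    SMul K (LeavittPathAlgebra K V) where
  smul c := Quotient.map (c • ·) fun _ _ h => con_smul c h

noncomputable instance instModule (K : Type u) [Field K] (V : Type v) [Quiver.{w} V] :
    Module K (LeavittPathAlgebra K V) :=
  Function.Surjective.module K
    (⟨⟨mk K V, rfl⟩, fun _ _ => rfl⟩ : FreeAlg K V →+ LeavittPathAlgebra K V)
    Quotient.mk_surjective (fun _ _ => rfl)

instance instIsScalarTower (K : Type u) [Field K] (V : Type v) [Quiver.{w} V] :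
    IsScalarTower K (LeavittPathAlgebra K V) (LeavittPathAlgebra K V) where
  smul_assoc c x y := by
    obtain ⟨x, rfl⟩ := Quotient.mk_surjective x
    obtain ⟨y, rfl⟩ := Quotient.mk_surjective y
    exact congrArg (mk K V) (smul_mul_assoc c x y)

instance instSMulCommClass (K : Type u) [Field K] (V : Type v) [Quiver.{w} V] :
    SMulCommClass K (LeavittPathAlgebra K V) (LeavittPathAlgebra K V) where
  smul_comm c x y := by
    obtain ⟨x, rfl⟩ := Quotient.mk_surjective x
    obtain ⟨y, rfl⟩ := Quotient.mk_surjective y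
    exact congrArg (mk K V) (mul_smul_comm c x y).symm

/-- A generator as an element of the Leavitt path algebra. -/
noncomputable def gen (K : Type u) [Field K] {V : Type v} [Quiver.{w} V] (x : Gen V) :
    LeavittPathAlgebra K V :=
  mk K V (FreeAlg.gen K x)

/-- A path `p = e₁ e₂ ⋯ eₘ` as an element of the Leavitt path algebra; the trivial path at a vertex
is that vertex. -/
noncomputable def path (K : Type u) [Field K] {V : Type v} [Quiver.{w} V] {a : V} :
    {b : V} → Quiver.Path a b → LeavittPathAlgebra K V
  | _, .nil => gen K (.vertex a)
  | _, .cons p e => path K p * gen K (.edge e)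

/-- For a path `p = e₁ e₂ ⋯ eₘ`, the element `p* = eₘ* ⋯ e₂* e₁*` of the Leavitt path algebra; for
a vertex `a`, `a* = a`. -/
noncomputable def pathStar (K : Type u) [Field K] {V : Type v} [Quiver.{w} V] {a : V} :
    {b : V} → Quiver.Path a b → LeavittPathAlgebra K V
  | _, .nil => gen K (.vertex a)
  | _, .cons p e => gen K (.ghost e) * pathStar K p

/-- The natural `ℤ`-grading: the `d`-component is the `K`-linear span of the elements `p q*` for
paths `p`, `q` with `|p| - |q| = d`. -/
noncomputable def grading (K : Type u) [Field K] (V : Type v) [Quiver.{w} V] (d : ℤ) :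
    Submodule K (LeavittPathAlgebra K V) :=
  Submodule.span K {x | ∃ (a b a' b' : V) (p : Quiver.Path a b) (q : Quiver.Path a' b'),
    (p.length : ℤ) - (q.length : ℤ) = d ∧ x = path K p * pathStar K q}

end LeavittPathAlgebra

/-! ### Graded matrix algebras and graded isomorphisms -/

/-- The trivial `ℤ`-grading of a field `K`: `K` in degree `0` and zero in all other degrees. -/
def trivialGrading (K : Type*) [Field K] (d : ℤ) : Submodule K K :=
  if d = 0 then ⊤ else ⊥

/-- For a `ℤ`-graded `K`-algebra `A` with components `𝒜 d`, the grading of the matrix algebra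
`𝕄ₙ(A)(γ₁, …, γₙ)`: the `d`-component consists of the matrices `(r i j)` with
`r i j ∈ 𝒜 (-γ i + d + γ j)` for all `i`, `j`. -/
def matrixGrading {K A ι : Type*} [Field K] [Ring A] [Algebra K A] (𝒜 : ℤ → Submodule K A)
    (γ : ι → ℤ) (d : ℤ) : Submodule K (Matrix ι ι A) where
  carrier := {r | ∀ i j, r i j ∈ 𝒜 (-γ i + d + γ j)}
  add_mem' hr hs i j := (𝒜 _).add_mem (hr i j) (hs i j)
  zero_mem' _ _ := (𝒜 _).zero_mem
  smul_mem' c _ hr i j := (𝒜 _).smul_mem c (hr i j)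

/-- `A` and `B`, with homogeneous components `𝒜 d` and `ℬ d`, are graded isomorphic as rings: there
is a ring isomorphism which maps each `𝒜 d` onto `ℬ d`. (Neither ring has to be unital.) -/
def GradedRingIsomorphic {K A B : Type*} [Field K]
    [NonUnitalRing A] [Module K A] [NonUnitalRing B] [Module K B]
    (𝒜 : ℤ → Submodule K A) (ℬ : ℤ → Submodule K B) : Prop :=
  ∃ f : A ≃+* B, ∀ (d : ℤ) (x : A), x ∈ 𝒜 d ↔ f x ∈ ℬ d

/-- `A` and `B`, with homogeneous components `𝒜 d` and `ℬ d`, are graded isomorphic as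
`K`-algebras: there is a `K`-linear ring isomorphism which maps each `𝒜 d` onto `ℬ d`. -/
def GradedAlgIsomorphic {K A B : Type*} [Field K]
    [NonUnitalRing A] [Module K A] [NonUnitalRing B] [Module K B]
    (𝒜 : ℤ → Submodule K A) (ℬ : ℤ → Submodule K B) : Prop :=
  ∃ f : A ≃+* B, (∀ (c : K) (x : A), f (c • x) = c • f x) ∧
    ∀ (d : ℤ) (x : A), x ∈ 𝒜 d ↔ f x ∈ ℬ d

/-! ### Lists of shifts -/

/-- The list `l₀(0), l₁(1), …, lₖ(k)`, in which each `i ≤ k` is repeated `l i` times. -/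
def shiftList (k : ℕ) (l : ℕ → ℕ) : List ℤ :=
  (List.range (k + 1)).flatMap fun i => List.replicate (l i) (i : ℤ)

/-- `k` and `l₀, …, lₖ` are the representatives of the graded isomorphism class of
`𝕄ₙ(K)(γ₁, …, γₙ)`: if the smallest element `m` is subtracted from the list `γ₁, …, γₙ` and the new
list is arranged in a nondecreasing order, then its largest element is `k` and it becomes
`l₀(0), l₁(1), …, lₖ(k)`. -/
def IsRepresentatives {n : ℕ} (γ : Fin n → ℤ) (k : ℕ) (l : ℕ → ℕ) : Prop :=
  ∃ m : ℤ, IsLeast (Set.range γ) m ∧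
    IsGreatest (Set.range fun i => γ i - m) (k : ℤ) ∧
    (List.ofFn fun i => γ i - m).insertionSort (· ≤ ·) = shiftList k l

/-!
The conditions on the multiplicities of the shifts say that `IsTreeShift γ` holds: the integers
`γ 1, …, γ n` attain their minimum exactly once and have no gaps. This is the property that connects
them with Leavitt path algebras.

If `γ` has this property, let each index other than that of the minimum emit one edge, to an index
whose shift is smaller by one. The graph is a tree with edges directed towards its only sink `r`. If
`p a` is the unique path from `a` to `r`, then the elements `p a (p b)*` are matrix units which span
the Leavitt path algebra, and the degree of `p a (p b)*` is `γ a - γ b`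
(`LeavittPathAlgebra.gradedAlgIsomorphic_of_tree`).

Conversely, let `R = 𝕄ₙ(K)(γ)` be graded isomorphic to `L = L_K(E)`. As `R` is nonzero in finitely
many degrees only, the graph has a vertex `w` which is nonzero in `L` and emits only edges which are
zero in `L` (`LeavittPathAlgebra.exists_isVirtualSink`): otherwise there would be arbitrarily long
paths `p` with `p* p ≠ 0`. The left ideal `L w` is spanned by the paths which end in `w`. Hence it is
zero in negative degrees and `K w` in degree `0`, and the degrees in which it is nonzero have no gaps,
as the first edge of a path can be removed. The corresponding left ideal of `R` is nonzero exactly in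
the degrees `γ i - min γ`, and in degree `0` it is one-dimensional only if the minimum is attained
once (`GradedRingIsomorphic.isTreeShift`). The argument uses neither that vertices are nonzero in
Leavitt path algebras nor that the isomorphism is `K`-linear, so it serves both versions of the
equivalence.
-/

/-! ### Paths in the Leavitt path algebra -/

namespace LeavittPathAlgebra

open LeavittPath

section Basic

variable {K : Type u} [Field K] {V : Type v} [Quiver.{w} V]

theorem mk_eq_of_rel {x y : FreeAlg K V} (h : Rel K V x y) : mk K V x = mk K V y :=
  (RingCon.eq _).2 (RingConGen.Rel.of _ _ ⟨1, x, y, h, (one_smul _ _).symm, (one_smul _ _).symm⟩)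

theorem mk_surjective : Function.Surjective (mk K V) :=
  Quotient.mk_surjective

theorem mk_sum {ι : Type*} (s : Finset ι) (x : ι → FreeAlg K V) :
    mk K V (∑ i ∈ s, x i) = ∑ i ∈ s, mk K V (x i) :=
  map_sum (⟨⟨mk K V, rfl⟩, fun _ _ => rfl⟩ : FreeAlg K V →+ LeavittPathAlgebra K V) x s

theorem vertex_mul_vertex (a : V) :
    gen K (.vertex a) * gen K (.vertex a) = gen K (.vertex a) :=
  mk_eq_of_rel (Rel.vertex_mul_vertex_self a)

theorem vertex_mul_vertex_of_ne {a b : V} (h : a ≠ b) :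
    gen K (.vertex a) * gen K (.vertex b) = 0 :=
  mk_eq_of_rel (Rel.vertex_mul_vertex_ne a b h)

theorem vertex_mul_edge {a b : V} (e : a ⟶ b) :
    gen K (.vertex a) * gen K (.edge e) = gen K (.edge e) :=
  mk_eq_of_rel (Rel.source_mul_edge e)

theorem edge_mul_vertex {a b : V} (e : a ⟶ b) :
    gen K (.edge e) * gen K (.vertex b) = gen K (.edge e) :=
  mk_eq_of_rel (Rel.edge_mul_range e)

theorem vertex_mul_ghost {a b : V} (e : a ⟶ b) :
    gen K (.vertex b) * gen K (.ghost e) = gen K (.ghost e) :=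
  mk_eq_of_rel (Rel.range_mul_ghost e)

theorem ghost_mul_vertex {a b : V} (e : a ⟶ b) :
    gen K (.ghost e) * gen K (.vertex a) = gen K (.ghost e) :=
  mk_eq_of_rel (Rel.ghost_mul_source e)

theorem ghost_mul_edge {a b : V} (e : a ⟶ b) :
    gen K (.ghost e) * gen K (.edge e) = gen K (.vertex b) :=
  mk_eq_of_rel (Rel.ghost_mul_edge_self e)

theorem sum_edge_mul_ghost (a : V) [Fintype (Quiver.Star a)] [Nonempty (Quiver.Star a)] :
    gen K (.vertex a) = ∑ e : Quiver.Star a, gen K (.edge e.2) * gen K (.ghost e.2) :=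
  (mk_eq_of_rel (Rel.sum_edge_mul_ghost a)).trans (mk_sum _ _)

/-- Every element is obtained from the generators by sums, products and scalar multiples. -/
theorem gen_induction {motive : LeavittPathAlgebra K V → Prop} (gen : ∀ x, motive (gen K x))
    (zero : motive 0) (add : ∀ x y, motive x → motive y → motive (x + y))
    (mul : ∀ x y, motive x → motive y → motive (x * y))
    (smul : ∀ (c : K) x, motive x → motive (c • x)) (x : LeavittPathAlgebra K V) : motive x := by
  obtain ⟨x, rfl⟩ := mk_surjective x
  have word (m : FreeSemigroup (Gen V)) : motive (mk K V (MonoidAlgebra.single m 1)) := by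
    induction m using FreeSemigroup.recOnMul with
    | ih1 x => exact gen x
    | ih2 x y hx hy =>
      have h : (MonoidAlgebra.single (FreeSemigroup.of x * y) 1 : FreeAlg K V) =
          MonoidAlgebra.single (FreeSemigroup.of x) 1 * MonoidAlgebra.single y 1 := by
        rw [MonoidAlgebra.single_mul_single, one_mul]
      rw [h]
      exact mul _ _ hx hy
  induction x using MonoidAlgebra.induction_linear with
  | zero => exact zero
  | add x y hx hy => exact add _ _ hx hy
  | single m c =>
    have h : (MonoidAlgebra.single m c : FreeAlg K V) = c • MonoidAlgebra.single m 1 := by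
      rw [MonoidAlgebra.smul_single, smul_eq_mul, mul_one]
    rw [h]
    exact smul c _ (word m)

/-- The universal property: values on the generators which respect the defining relations extend
to a homomorphism. -/
theorem exists_lift {A : Type*} [NonUnitalRing A] [Module K A] [IsScalarTower K A A]
    [SMulCommClass K A A] (g : Gen V → A)
    (h : ∀ F : FreeAlg K V →ₙₐ[K] A, (∀ x, F (FreeAlg.gen K x) = g x) →
      ∀ x y, Rel K V x y → F x = F y) :
    ∃ φ : LeavittPathAlgebra K V →ₙₐ[K] A, ∀ x, φ (gen K x) = g x := by
  let F : FreeAlg K V →ₙₐ[K] A := MonoidAlgebra.liftMagma K (FreeSemigroup.lift g)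
  have hF (x : Gen V) : F (FreeAlg.gen K x) = g x := by
    simp [F, FreeAlg.gen]
  have hcon (x y : FreeAlg K V) (hxy : con K V x y) : F x = F y := by
    have hxy' : RingConGen.Rel
      (fun x y => ∃ (c : K) (a b : FreeAlg K V), Rel K V a b ∧ x = c • a ∧ y = c • b) x y := hxy
    clear hxy
    induction hxy' with
    | of x y hxy =>
      obtain ⟨c, a, b, hab, rfl, rfl⟩ := hxy
      rw [map_smul, map_smul, h F hF a b hab]
    | refl x => rfl
    | symm _ ih => exact ih.symm
    | trans _ _ ih₁ ih₂ => exact ih₁.trans ih₂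
    | add _ _ ih₁ ih₂ => rw [map_add, map_add, ih₁, ih₂]
    | mul _ _ ih₁ ih₂ => rw [map_mul, map_mul, ih₁, ih₂]
  refine ⟨{ toFun := Quotient.lift F hcon
            map_smul' := ?_
            map_zero' := map_zero F
            map_add' := ?_
            map_mul' := ?_ }, hF⟩
  · intro c x
    obtain ⟨x, rfl⟩ := mk_surjective x
    exact map_smul F c x
  · intro x y
    obtain ⟨x, rfl⟩ := mk_surjective x
    obtain ⟨y, rfl⟩ := mk_surjective y
    exact map_add F x y
  · intro x y
    obtain ⟨x, rfl⟩ := mk_surjective x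
    obtain ⟨y, rfl⟩ := mk_surjective y
    exact map_mul F x y

@[simp]
theorem path_cons {a b c : V} (p : Quiver.Path a b) (e : b ⟶ c) :
    path K (p.cons e) = path K p * gen K (.edge e) := rfl

@[simp]
theorem pathStar_nil (a : V) : pathStar K (.nil : Quiver.Path a a) = gen K (.vertex a) := rfl

@[simp]
theorem pathStar_cons {a b c : V} (p : Quiver.Path a b) (e : b ⟶ c) :
    pathStar K (p.cons e) = gen K (.ghost e) * pathStar K p := rfl

theorem vertex_mul_path {a b : V} (p : Quiver.Path a b) :
    gen K (.vertex a) * path K p = path K p := by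
  induction p with
  | nil => exact vertex_mul_vertex a
  | cons p e ih => rw [path_cons, ← mul_assoc, ih]

theorem path_mul_vertex {a b : V} (p : Quiver.Path a b) :
    path K p * gen K (.vertex b) = path K p := by
  cases p with
  | nil => exact vertex_mul_vertex a
  | cons p e => rw [path_cons, mul_assoc, edge_mul_vertex]

theorem pathStar_mul_vertex {a b : V} (p : Quiver.Path a b) :
    pathStar K p * gen K (.vertex a) = pathStar K p := by
  induction p with
  | nil => exact vertex_mul_vertex a
  | cons p e ih => rw [pathStar_cons, mul_assoc, ih]

theorem vertex_mul_pathStar {a b : V} (p : Quiver.Path a b) :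
    gen K (.vertex b) * pathStar K p = pathStar K p := by
  cases p with
  | nil => exact vertex_mul_vertex a
  | cons p e => rw [pathStar_cons, ← mul_assoc, vertex_mul_ghost]

theorem path_mul_vertex_of_ne {a b c : V} (p : Quiver.Path a b) (h : b ≠ c) :
    path K p * gen K (.vertex c) = 0 := by
  rw [← path_mul_vertex, mul_assoc, vertex_mul_vertex_of_ne h, mul_zero]

theorem pathStar_mul_vertex_of_ne {a b c : V} (p : Quiver.Path a b) (h : a ≠ c) :
    pathStar K p * gen K (.vertex c) = 0 := by
  rw [← pathStar_mul_vertex, mul_assoc, vertex_mul_vertex_of_ne h, mul_zero]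

theorem path_comp {a b c : V} (p : Quiver.Path a b) (q : Quiver.Path b c) :
    path K (p.comp q) = path K p * path K q := by
  induction q with
  | nil => exact (path_mul_vertex p).symm
  | cons q e ih => rw [Quiver.Path.comp_cons, path_cons, path_cons, ih, mul_assoc]

theorem path_toPath {a b : V} (e : a ⟶ b) : path K e.toPath = gen K (.edge e) :=
  vertex_mul_edge e

theorem pathStar_comp {a b c : V} (p : Quiver.Path a b) (q : Quiver.Path b c) :
    pathStar K (p.comp q) = pathStar K q * pathStar K p := by
  induction q with
  | nil => exact (vertex_mul_pathStar p).symm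
  | cons q e ih => rw [Quiver.Path.comp_cons, pathStar_cons, pathStar_cons, ih, mul_assoc]

theorem pathStar_toPath {a b : V} (e : a ⟶ b) : pathStar K e.toPath = gen K (.ghost e) :=
  ghost_mul_vertex e

theorem pathStar_mul_path {a b : V} (p : Quiver.Path a b) :
    pathStar K p * path K p = gen K (.vertex b) := by
  induction p with
  | nil => exact vertex_mul_vertex a
  | cons p e ih =>
    rw [pathStar_cons, path_cons, mul_assoc, ← mul_assoc _ (path K p), ih, vertex_mul_edge,
      ghost_mul_edge]

theorem path_mul_pathStar_mem_grading {a b a' b' : V} (p : Quiver.Path a b)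
    (q : Quiver.Path a' b') :
    path K p * pathStar K q ∈ grading K V ((p.length : ℤ) - (q.length : ℤ)) :=
  Submodule.subset_span ⟨a, b, a', b', p, q, rfl, rfl⟩

theorem path_mem_grading {a b : V} (p : Quiver.Path a b) :
    path K p ∈ grading K V (p.length : ℤ) := by
  simpa [path_mul_vertex] using path_mul_pathStar_mem_grading (K := K) p (.nil : Quiver.Path b b)

theorem vertex_eq_zero_of_edge_eq_zero {a b : V} {e : a ⟶ b}
    (h : gen K (.edge e) = 0) : gen K (.vertex b) = 0 := by
  rw [← ghost_mul_edge e, h, mul_zero]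

end Basic

/-! ### Vertices which emit only zero edges -/

/-- A vertex which is nonzero in the Leavitt path algebra, while all edges it emits are zero there.
This is the property of a sink on which the description of `L_K(E) w` depends; it can be verified
without knowing that vertices and edges are always nonzero in `L_K(E)`. -/
def IsVirtualSink (K : Type u) [Field K] {V : Type v} [Quiver.{w} V] (a : V) : Prop :=
  gen K (.vertex a) ≠ 0 ∧ ∀ (b : V) (e : a ⟶ b), gen K (.edge e) = 0

section VirtualSink

variable {K : Type u} [Field K] {V : Type v} [Quiver.{w} V]

/-- If no vertex were a virtual sink, every nonzero vertex would emit a nonzero edge, whose range is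
again a nonzero vertex. This yields arbitrarily long paths `p` with `p* p ≠ 0`, so the grading would
be unbounded. -/
theorem exists_isVirtualSink {N d : ℤ} {x : LeavittPathAlgebra K V}
    (hN : ∀ d, N < d → ∀ y ∈ grading K V d, y = 0) (hx : x ∈ grading K V d) (hx0 : x ≠ 0) :
    ∃ a : V, IsVirtualSink K a := by
  by_contra! hns
  have hedge (a : V) (ha : gen K (.vertex a) ≠ 0) :
      ∃ (b : V) (_ : a ⟶ b), gen K (.vertex b) ≠ 0 := by
    by_contra! h
    exact hns a ⟨ha, fun b e => by rw [← edge_mul_vertex, h b e, mul_zero]⟩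
  obtain ⟨a, ha⟩ : ∃ a : V, gen K (.vertex a) ≠ 0 := by
    by_contra! h
    refine hx0 ((Submodule.mem_bot K).1 (Submodule.span_le.2 ?_ hx))
    rintro _ ⟨a, b, a', b', p, q, -, rfl⟩
    rw [← vertex_mul_path, h a, zero_mul, zero_mul]
    exact Submodule.zero_mem _
  have hpath (m : ℕ) : ∃ (b : V) (p : Quiver.Path a b), p.length = m ∧ gen K (.vertex b) ≠ 0 := by
    induction m with
    | zero => exact ⟨a, .nil, rfl, ha⟩
    | succ m ih =>
      obtain ⟨b, p, hp, hb⟩ := ih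
      obtain ⟨c, e, hc⟩ := hedge b hb
      exact ⟨c, p.cons e, by rw [Quiver.Path.length_cons, hp], hc⟩
  obtain ⟨b, p, hp, hb⟩ := hpath (N.toNat + 1)
  refine hb ?_
  rw [← pathStar_mul_path p, hN p.length (by omega) _ (path_mem_grading p), mul_zero]

theorem IsVirtualSink.pathStar_eq_zero {a b : V} (ha : IsVirtualSink K a) (q : Quiver.Path a b)
    (hq : 0 < q.length) : pathStar K q = 0 := by
  induction q with
  | nil => simp at hq
  | cons q e ih =>
    rw [pathStar_cons]
    rcases Nat.eq_zero_or_pos q.length with h | h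
    · obtain rfl := q.eq_of_length_zero h
      rw [← vertex_mul_ghost, vertex_eq_zero_of_edge_eq_zero (ha.2 _ e), zero_mul, zero_mul]
    · rw [ih h, mul_zero]

/-- The left ideal `L_K(E) w` of a virtual sink `w` is spanned, degree by degree, by the paths
which end in `w`. -/
theorem IsVirtualSink.mul_vertex_mem_span {a : V} (ha : IsVirtualSink K a) {d : ℤ}
    {x : LeavittPathAlgebra K V} (hx : x ∈ grading K V d) :
    x * gen K (.vertex a) ∈
      Submodule.span K {y | ∃ (b : V) (p : Quiver.Path b a), (p.length : ℤ) = d ∧ y = path K p} := by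
  induction hx using Submodule.span_induction with
  | mem x hx =>
    obtain ⟨b, c, b', c', p, q, hd, rfl⟩ := hx
    rcases eq_or_ne b' a with rfl | hb
    · rcases Nat.eq_zero_or_pos q.length with hq | hq
      · obtain rfl := q.eq_of_length_zero hq
        obtain rfl := q.eq_nil_of_length_zero hq
        rw [pathStar_nil, mul_assoc, vertex_mul_vertex]
        rcases eq_or_ne c b' with rfl | hc
        · rw [path_mul_vertex]
          exact Submodule.subset_span ⟨b, p, by simpa using hd, rfl⟩
        · rw [path_mul_vertex_of_ne p hc]
          exact Submodule.zero_mem _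
      · rw [ha.pathStar_eq_zero q hq, mul_zero, zero_mul]
        exact Submodule.zero_mem _
    · rw [mul_assoc, pathStar_mul_vertex_of_ne q hb, mul_zero]
      exact Submodule.zero_mem _
  | zero =>
    rw [zero_mul]
    exact Submodule.zero_mem _
  | add x y _ _ hx hy =>
    rw [add_mul]
    exact Submodule.add_mem _ hx hy
  | smul c x _ hx =>
    rw [smul_mul_assoc]
    exact Submodule.smul_mem _ c hx

theorem IsVirtualSink.mul_vertex_eq_zero {a : V} (ha : IsVirtualSink K a) {d : ℤ} (hd : d < 0)
    {x : LeavittPathAlgebra K V} (hx : x ∈ grading K V d) : x * gen K (.vertex a) = 0 := by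
  refine (Submodule.mem_bot K).1 (Submodule.span_le.2 ?_ (ha.mul_vertex_mem_span hx))
  rintro _ ⟨b, p, hp, -⟩
  omega

theorem IsVirtualSink.exists_mul_vertex_eq_smul {a : V} (ha : IsVirtualSink K a)
    {x : LeavittPathAlgebra K V} (hx : x ∈ grading K V 0) :
    ∃ c : K, x * gen K (.vertex a) = c • gen K (.vertex a) := by
  have h : x * gen K (.vertex a) ∈ Submodule.span K {gen K (.vertex a)} := by
    refine Submodule.span_mono ?_ (ha.mul_vertex_mem_span hx)
    rintro _ ⟨b, p, hp, rfl⟩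
    have hp : p.length = 0 := by exact_mod_cast hp
    obtain rfl := p.eq_of_length_zero hp
    obtain rfl := p.eq_nil_of_length_zero hp
    rfl
  obtain ⟨c, hc⟩ := Submodule.mem_span_singleton.1 h
  exact ⟨c, hc.symm⟩

/-- The degrees in which `L_K(E) w` is nonzero have no gaps: the first edge of a path can be
removed. -/
theorem IsVirtualSink.exists_mul_vertex_ne_zero {a : V} (ha : IsVirtualSink K a) (d : ℕ)
    {x : LeavittPathAlgebra K V} (hx : x ∈ grading K V (d + 1 : ℤ))
    (hx0 : x * gen K (.vertex a) ≠ 0) :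
    ∃ y ∈ grading K V (d : ℤ), y * gen K (.vertex a) ≠ 0 := by
  by_contra! h
  refine hx0 ((Submodule.mem_bot K).1 (Submodule.span_le.2 ?_ (ha.mul_vertex_mem_span hx)))
  rintro _ ⟨b, p, hp, rfl⟩
  obtain ⟨c, e, q, hq, rfl⟩ := p.eq_toPath_comp_of_length_eq_succ (n := d) (by exact_mod_cast hp)
  have := h (path K q) (hq ▸ path_mem_grading q)
  rw [path_mul_vertex] at this
  rw [path_comp, this, mul_zero]
  exact Submodule.zero_mem _

end VirtualSink

end LeavittPathAlgebra

/-! ### Graded isomorphisms -/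

section GradedIsomorphic

variable {K A B C : Type*} [Field K] [NonUnitalRing A] [Module K A] [NonUnitalRing B] [Module K B]
  [NonUnitalRing C] [Module K C] {𝒜 : ℤ → Submodule K A} {ℬ : ℤ → Submodule K B}
  {𝒞 : ℤ → Submodule K C}

theorem GradedAlgIsomorphic.gradedRingIsomorphic (h : GradedAlgIsomorphic 𝒜 ℬ) :
    GradedRingIsomorphic 𝒜 ℬ :=
  let ⟨f, _, hf⟩ := h
  ⟨f, hf⟩

theorem GradedRingIsomorphic.trans (h : GradedRingIsomorphic 𝒜 ℬ) (h' : GradedRingIsomorphic ℬ 𝒞) :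
    GradedRingIsomorphic 𝒜 𝒞 :=
  let ⟨f, hf⟩ := h
  let ⟨g, hg⟩ := h'
  ⟨f.trans g, fun d x => (hf d x).trans (hg d (f x))⟩

theorem GradedAlgIsomorphic.trans (h : GradedAlgIsomorphic 𝒜 ℬ) (h' : GradedAlgIsomorphic ℬ 𝒞) :
    GradedAlgIsomorphic 𝒜 𝒞 :=
  let ⟨f, hfK, hf⟩ := h
  let ⟨g, hgK, hg⟩ := h'
  ⟨f.trans g, fun c x => (congrArg g (hfK c x)).trans (hgK c (f x)),
    fun d x => (hf d x).trans (hg d (f x))⟩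

end GradedIsomorphic

/-! ### Matrix algebras over a trivially graded field -/

theorem mem_trivialGrading {K : Type*} [Field K] {d : ℤ} {c : K} :
    c ∈ trivialGrading K d ↔ c ≠ 0 → d = 0 := by
  unfold trivialGrading
  split_ifs with h
  · simp [h]
  · simp only [Submodule.mem_bot, h]
    tauto

theorem mem_matrixGrading {K ι : Type*} [Field K] {γ : ι → ℤ} {d : ℤ} {r : Matrix ι ι K} :
    r ∈ matrixGrading (trivialGrading K) γ d ↔ ∀ i j, r i j ≠ 0 → γ i = d + γ j := by
  refine forall₂_congr fun i j => mem_trivialGrading.trans (imp_congr_right fun _ => ?_)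
  omega

theorem single_mem_matrixGrading {K ι : Type*} [Field K] [DecidableEq ι] (γ : ι → ℤ) (i j : ι)
    (c : K) : Matrix.single i j c ∈ matrixGrading (trivialGrading K) γ (γ i - γ j) := by
  refine mem_matrixGrading.2 fun i' j' h => ?_
  rw [Matrix.single_apply] at h
  obtain ⟨⟨rfl, rfl⟩, -⟩ := ite_ne_right_iff.1 h
  omega

/-- Permuting the shifts and adding a constant to them does not change the graded isomorphism
class. -/
theorem gradedAlgIsomorphic_reindex {K ι κ : Type*} [Field K] [Fintype ι] [Fintype κ]
    [DecidableEq ι] [DecidableEq κ] (e : ι ≃ κ) {γ : ι → ℤ} {δ : κ → ℤ} (c : ℤ)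
    (h : ∀ i, γ i = δ (e i) + c) :
    GradedAlgIsomorphic (matrixGrading (trivialGrading K) γ)
      (matrixGrading (trivialGrading K) δ) := by
  refine ⟨(Matrix.reindexAlgEquiv K K e).toRingEquiv,
    fun c x => map_smul (Matrix.reindexAlgEquiv K K e) c x, fun d x => ?_⟩
  rw [mem_matrixGrading, mem_matrixGrading]
  constructor
  · intro hx i j hij
    have := hx (e.symm i) (e.symm j) hij
    rw [h, h, e.apply_symm_apply, e.apply_symm_apply] at this
    omega
  · intro hx i j hij
    have := hx (e i) (e j) (by simpa using hij)
    rw [h, h]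
    omega

/-! ### Shifts of Leavitt path algebras -/

/-- The family `γ` attains its minimum exactly once, and its values have no gaps: they form an
interval of integers. Equivalently, `ι` is the vertex set of a rooted tree, with edges directed
towards the root, such that `γ i - γ r` is the distance of `i` from the root `r`. -/
def IsTreeShift {ι : Type*} (γ : ι → ℤ) : Prop :=
  ∃ r, ∀ i, i ≠ r → γ r < γ i ∧ ∃ j, γ j = γ i - 1

open LeavittPathAlgebra in
/-- Let `w` be a virtual sink of `E` and `ε` the corresponding idempotent of the matrix algebra. As
the left ideal generated by `w` is one-dimensional in degree `0`, vanishes in negative degrees and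
has no gaps, the same holds for the left ideal generated by `ε`, whose nonzero components are those
in the degrees `γ i - min γ`. -/
theorem GradedRingIsomorphic.isTreeShift {K : Type u} [Field K] {V : Type v} [Quiver.{w} V]
    {n : ℕ} (hn : 0 < n) {γ : Fin n → ℤ}
    (h : GradedRingIsomorphic (matrixGrading (trivialGrading K) γ) (grading K V)) :
    IsTreeShift γ := by
  obtain ⟨f, hf⟩ := h
  obtain ⟨N, hN⟩ : ∃ N : ℤ, ∀ i j, γ i - γ j ≤ N := by
    obtain ⟨N, hN⟩ := (Set.finite_range fun x : Fin n × Fin n => γ x.1 - γ x.2).bddAbove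
    exact ⟨N, fun i j => hN ⟨(i, j), rfl⟩⟩
  obtain ⟨w, hw⟩ : ∃ w : V, IsVirtualSink K w := by
    let i : Fin n := ⟨0, hn⟩
    refine exists_isVirtualSink (N := N) (fun d hd y hy => ?_)
      ((hf _ _).1 (single_mem_matrixGrading γ i i (1 : K))) ?_
    · obtain ⟨x, rfl⟩ := f.surjective y
      rw [← hf, mem_matrixGrading] at hy
      refine (map_eq_zero_iff f f.injective).2 (Matrix.ext fun i j => ?_)
      by_contra hij
      have := hy i j hij
      have := hN i j
      omega
    · rw [Ne, map_eq_zero_iff f f.injective]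
      intro h
      simpa using congrFun (congrFun h i) i
  set ω := gen K (.vertex w) with hω
  obtain ⟨ε, hε⟩ := f.surjective ω
  have hmul (x) : f (x * ε) = f x * ω := by rw [map_mul, hε]
  have hε0 : ε ∈ matrixGrading (trivialGrading K) γ 0 := by
    rw [hf, hε]
    exact path_mem_grading (K := K) (.nil : Quiver.Path w w)
  rw [mem_matrixGrading] at hε0
  have hne (x : Matrix (Fin n) (Fin n) K) : x * ε ≠ 0 ↔ f x * ω ≠ 0 := by
    rw [← hmul, Ne, Ne, map_eq_zero_iff f f.injective]
  have hcol {i k j} (hkj : ε k j ≠ 0) : f (Matrix.single i k 1) * ω ≠ 0 := by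
    rw [← hne]
    intro h
    apply hkj
    simpa using congrFun (congrFun h i) j
  have hmin {k j} (hkj : ε k j ≠ 0) (i) : γ k ≤ γ i := by
    by_contra! hlt
    exact hcol hkj (hw.mul_vertex_eq_zero (sub_neg.2 hlt)
      ((hf _ _).1 (single_mem_matrixGrading γ i k 1)))
  obtain ⟨r, s, hrs⟩ : ∃ r s, ε r s ≠ 0 := by
    by_contra! h
    refine hw.1 ?_
    rw [← hω, ← hε, map_eq_zero_iff f f.injective]
    exact Matrix.ext h
  refine ⟨r, fun i hir => ?_⟩
  have hlt : γ r < γ i := by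
    refine lt_of_le_of_ne (hmin hrs i) fun heq => ?_
    -- Both `E i r * ε` and `E r r * ε` correspond to nonzero multiples of `w`, while
    -- `E r r * (E i r * ε) = 0`.
    have hscalar (j) (hj : γ j = γ r) :
        ∃ c : K, c ≠ 0 ∧ f (Matrix.single j r 1) * ω = c • ω := by
      obtain ⟨c, hc⟩ := hw.exists_mul_vertex_eq_smul (x := f (Matrix.single j r 1)) (by
        have := (hf _ _).1 (single_mem_matrixGrading γ j r (1 : K))
        rwa [hj, sub_self] at this)
      refine ⟨c, ?_, hc⟩
      rintro rfl
      exact hcol hrs (hc.trans (zero_smul K _))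
    obtain ⟨c, hc, hcω⟩ := hscalar i heq.symm
    obtain ⟨c', hc', hcω'⟩ := hscalar r rfl
    have hzero : f (Matrix.single r r 1) * (f (Matrix.single i r 1) * ω) = 0 := by
      rw [← mul_assoc, ← map_mul, Matrix.single_mul_single_of_ne _ _ _ _ hir.symm, map_zero,
        zero_mul]
    rw [hcω, mul_smul_comm, hcω', smul_smul] at hzero
    exact smul_ne_zero (mul_ne_zero hc hc') hw.1 hzero
  refine ⟨hlt, ?_⟩
  obtain ⟨d, hd⟩ : ∃ d : ℕ, γ i - γ r = d + 1 := ⟨(γ i - γ r - 1).toNat, by omega⟩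
  obtain ⟨y, hy, hy0⟩ := hw.exists_mul_vertex_ne_zero d
    (hd ▸ (hf _ _).1 (single_mem_matrixGrading γ i r (1 : K))) (hcol hrs)
  obtain ⟨x, rfl⟩ := f.surjective y
  rw [← hf, mem_matrixGrading] at hy
  rw [← hω, ← hne] at hy0
  obtain ⟨j, j', hj⟩ : ∃ j j', (x * ε) j j' ≠ 0 := by
    by_contra! h
    exact hy0 (Matrix.ext h)
  rw [Matrix.mul_apply] at hj
  obtain ⟨k, -, hk⟩ := Finset.exists_ne_zero_of_sum_ne_zero hj
  have h₁ := hy j k (left_ne_zero_of_mul hk)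
  have h₂ := hmin (right_ne_zero_of_mul hk) r
  have h₃ := hmin hrs k
  exact ⟨j, by omega⟩

/-! ### The Leavitt path algebra of a tree -/

namespace LeavittPathAlgebra

open LeavittPath

/-- In a graph in which no vertex emits two edges, there is at most one path from a vertex to a
given sink. -/
theorem path_eq_of_subsingleton_star {V : Type v} [Quiver.{w} V] {r : V} (hr : IsSink r)
    (hs : ∀ a : V, Subsingleton (Quiver.Star a)) (m : ℕ) :
    ∀ {a : V} (p q : Quiver.Path a r), p.length = m → p = q := by
  induction m with
  | zero =>
    intro a p q hp
    obtain rfl := p.eq_of_length_zero hp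
    obtain rfl := p.eq_nil_of_length_zero hp
    rcases hq : q.length with _ | k
    · exact (q.eq_nil_of_length_zero hq).symm
    · obtain ⟨c, e, -⟩ := q.eq_toPath_comp_of_length_eq_succ hq
      exact (hr.false ⟨c, e⟩).elim
  | succ m ih =>
    intro a p q hp
    obtain ⟨b, e, p, hp', rfl⟩ := p.eq_toPath_comp_of_length_eq_succ hp
    rcases hq : q.length with _ | k
    · obtain rfl := q.eq_of_length_zero hq
      exact (hr.false ⟨b, e⟩).elim
    · obtain ⟨c, e', q, -, rfl⟩ := q.eq_toPath_comp_of_length_eq_succ hq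
      cases (hs a).elim ⟨b, e⟩ ⟨c, e'⟩
      rw [ih p q hp']

theorem edge_mul_ghost {K : Type u} [Field K] {V : Type v} [Quiver.{w} V] {a b : V}
    [Subsingleton (Quiver.Star a)] (e : a ⟶ b) :
    gen K (.edge e) * gen K (.ghost e) = gen K (.vertex a) := by
  let : Fintype (Quiver.Star a) := Fintype.ofSubsingleton ⟨b, e⟩
  have : Nonempty (Quiver.Star a) := ⟨⟨b, e⟩⟩
  rw [sum_edge_mul_ghost a, Fintype.sum_subsingleton _ (⟨b, e⟩ : Quiver.Star a)]

theorem path_mul_pathStar {K : Type u} [Field K] {V : Type v} [Quiver.{w} V]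
    (hs : ∀ a : V, Subsingleton (Quiver.Star a)) {a b : V} (p : Quiver.Path a b) :
    path K p * pathStar K p = gen K (.vertex a) := by
  induction p with
  | nil => exact vertex_mul_vertex a
  | @cons b c p e ih =>
    have := hs b
    rw [path_cons, pathStar_cons, mul_assoc, ← mul_assoc (gen K (.edge e)), edge_mul_ghost,
      vertex_mul_pathStar, ih]

/-- The matrix unit which corresponds to a generator: `E a a` for a vertex `a`, and `E a b` and
`E b a` for an edge from `a` to `b` and its ghost edge. -/
def matrixUnit (K : Type u) [Field K] {V : Type v} [Quiver.{w} V] [DecidableEq V] :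
    Gen V → Matrix V V K
  | .vertex a => Matrix.single a a 1
  | @Gen.edge _ _ a b _ => Matrix.single a b 1
  | @Gen.ghost _ _ a b _ => Matrix.single b a 1

/-- If every vertex emits at most one edge, the matrix units satisfy the defining relations of the
Leavitt path algebra. -/
theorem exists_toMatrix {K : Type u} [Field K] {V : Type v} [Quiver.{w} V] [Fintype V]
    [DecidableEq V] (hs : ∀ a : V, Subsingleton (Quiver.Star a)) :
    ∃ φ : LeavittPathAlgebra K V →ₙₐ[K] Matrix V V K, ∀ x, φ (gen K x) = matrixUnit K x := by
  refine exists_lift _ fun F hF x y hxy => ?_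
  cases hxy with
  | vertex_mul_vertex_ne a b h =>
    rw [map_mul, hF, hF, map_zero]
    exact Matrix.single_mul_single_of_ne _ _ _ _ h _
  | ghost_mul_edge_ne e f h =>
    rw [map_mul, hF, hF, map_zero]
    refine Matrix.single_mul_single_of_ne _ _ _ _ (fun hef => h ?_) _
    obtain ⟨a, b, e⟩ := e
    obtain ⟨a', b', f⟩ := f
    obtain rfl : a = a' := hef
    cases (hs a).elim ⟨b, e⟩ ⟨b', f⟩
    rfl
  | sum_edge_mul_ghost a =>
    obtain ⟨e⟩ := ‹Nonempty (Quiver.Star a)›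
    have := hs a
    rw [Fintype.sum_subsingleton _ e, map_mul, hF, hF, hF]
    simp [matrixUnit]
  | _ =>
    rw [map_mul]
    simp [hF, matrixUnit]

theorem map_path_eq_single {K : Type u} [Field K] {V : Type v} [Quiver.{w} V] [Fintype V]
    [DecidableEq V] {φ : LeavittPathAlgebra K V →ₙₐ[K] Matrix V V K}
    (hφ : ∀ x, φ (gen K x) = matrixUnit K x) {a b : V} (p : Quiver.Path a b) :
    φ (path K p) = Matrix.single a b 1 := by
  induction p with
  | nil => exact hφ _
  | cons p e ih => rw [path_cons, map_mul, ih, hφ]; simp [matrixUnit]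

theorem map_pathStar_eq_single {K : Type u} [Field K] {V : Type v} [Quiver.{w} V] [Fintype V]
    [DecidableEq V] {φ : LeavittPathAlgebra K V →ₙₐ[K] Matrix V V K}
    (hφ : ∀ x, φ (gen K x) = matrixUnit K x) {a b : V} (p : Quiver.Path a b) :
    φ (pathStar K p) = Matrix.single b a 1 := by
  induction p with
  | nil => exact hφ _
  | cons p e ih => rw [pathStar_cons, map_mul, ih, hφ]; simp [matrixUnit]

theorem length_add_eq {V : Type v} [Quiver.{w} V] {γ : V → ℤ}
    (hγ : ∀ (a b : V) (_ : a ⟶ b), γ a = γ b + 1) {a b : V} (p : Quiver.Path a b) :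
    p.length + γ b = γ a := by
  induction p with
  | nil => simp
  | cons p e ih =>
    have := hγ _ _ e
    rw [Quiver.Path.length_cons]
    push_cast
    omega

/-- In a tree with root `r`, let `p a` be the path from `a` to `r`. The elements `p a (p b)*` are
matrix units which span the Leavitt path algebra. -/
theorem gradedAlgIsomorphic_of_tree {K : Type u} [Field K] {V : Type v} [Quiver.{w} V] [Fintype V]
    [DecidableEq V] {r : V} (hr : IsSink r) (hs : ∀ a : V, Subsingleton (Quiver.Star a))
    (p : ∀ a : V, Quiver.Path a r) {γ : V → ℤ} (hγ : ∀ (a b : V) (_ : a ⟶ b), γ a = γ b + 1) :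
    GradedAlgIsomorphic (matrixGrading (trivialGrading K) γ) (grading K V) := by
  obtain ⟨φ, hφ⟩ := exists_toMatrix (K := K) hs
  have hpe {a b : V} (e : a ⟶ b) : path K (p a) = gen K (.edge e) * path K (p b) := by
    rw [path_eq_of_subsingleton_star hr hs _ (p a) (e.toPath.comp (p b)) rfl, path_comp,
      path_toPath]
  let u (a b : V) : LeavittPathAlgebra K V := path K (p a) * pathStar K (p b)
  have hu (a b : V) : φ (u a b) = Matrix.single a b 1 := by
    rw [map_mul, map_path_eq_single hφ, map_pathStar_eq_single hφ, Matrix.single_mul_single_same,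
      one_mul]
  have hu_mul (a b c : V) : u a b * u b c = u a c := by
    change path K (p a) * pathStar K (p b) * (path K (p b) * pathStar K (p c)) = _
    rw [mul_assoc, ← mul_assoc (pathStar K (p b)), pathStar_mul_path, vertex_mul_pathStar]
  have hu_mul_ne (a b b' c : V) (h : b ≠ b') : u a b * u b' c = 0 := by
    change path K (p a) * pathStar K (p b) * (path K (p b') * pathStar K (p c)) = _
    rw [mul_assoc, ← mul_assoc (pathStar K (p b)), ← vertex_mul_path (p b'), ← mul_assoc
      (pathStar K (p b)), pathStar_mul_vertex_of_ne _ h, zero_mul, zero_mul, mul_zero]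
  let ψ : Matrix V V K →ₗ[K] LeavittPathAlgebra K V :=
    { toFun := fun x => ∑ a, ∑ b, x a b • u a b
      map_add' := fun x y => by simp [add_smul, Finset.sum_add_distrib]
      map_smul' := fun c x => by simp [mul_smul, Finset.smul_sum] }
  have hψ_single (a b : V) : ψ (Matrix.single a b 1) = u a b := by
    change ∑ a', ∑ b', (Matrix.single a b (1 : K)) a' b' • u a' b' = u a b
    rw [Finset.sum_eq_single a, Finset.sum_eq_single b]
    · simp
    · intro b' _ hb
      simp [hb.symm]
    · simp
    · intro a' _ ha
      simp [ha.symm]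
    · simp
  have hψ_mul (x y : Matrix V V K) : ψ (x * y) = ψ x * ψ y := by
    change ∑ a, ∑ c, (x * y) a c • u a c = (∑ a, ∑ b, x a b • u a b) * ∑ b, ∑ c, y b c • u b c
    rw [Finset.sum_mul]
    refine Finset.sum_congr rfl fun a _ => ?_
    rw [Finset.sum_mul]
    simp_rw [Matrix.mul_apply, Finset.sum_smul]
    rw [Finset.sum_comm]
    refine Finset.sum_congr rfl fun b _ => ?_
    rw [Finset.mul_sum]
    refine Eq.trans ?_ (Finset.sum_eq_single b ?_ ?_).symm
    · rw [Finset.mul_sum]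
      refine Finset.sum_congr rfl fun c _ => ?_
      rw [smul_mul_smul_comm, hu_mul]
    · intro b' _ hb
      rw [Finset.mul_sum]
      refine Finset.sum_eq_zero fun c _ => ?_
      rw [smul_mul_smul_comm, hu_mul_ne _ _ _ _ hb.symm, smul_zero]
    · simp
  have hφψ (x : Matrix V V K) : φ (ψ x) = x := by
    change φ (∑ a, ∑ b, x a b • u a b) = x
    conv_rhs => rw [Matrix.matrix_eq_sum_single x]
    simp_rw [map_sum, map_smul, hu, Matrix.smul_single, smul_eq_mul, mul_one]
  have hψφ (x : LeavittPathAlgebra K V) : ψ (φ x) = x := by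
    induction x using gen_induction with
    | gen x =>
      rw [hφ]
      cases x with
      | vertex a => exact (hψ_single a a).trans (path_mul_pathStar hs (p a))
      | @edge a b e =>
        refine (hψ_single a b).trans ?_
        change path K (p a) * pathStar K (p b) = _
        rw [hpe e, mul_assoc, path_mul_pathStar hs, edge_mul_vertex]
      | @ghost a b e =>
        refine (hψ_single b a).trans ?_
        change path K (p b) * pathStar K (p a) = _
        have hpe' : pathStar K (p a) = pathStar K (p b) * gen K (.ghost e) := by
          rw [path_eq_of_subsingleton_star hr hs _ (p a) (e.toPath.comp (p b)) rfl, pathStar_comp,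
            pathStar_toPath]
        rw [hpe', ← mul_assoc, path_mul_pathStar hs, vertex_mul_ghost]
    | zero => rw [map_zero, map_zero]
    | add x y hx hy => rw [map_add, map_add, hx, hy]
    | mul x y hx hy => rw [map_mul, hψ_mul, hx, hy]
    | smul c x hx => rw [map_smul, map_smul, hx]
  have hψ_mem {d : ℤ} {x : Matrix V V K} (hx : x ∈ matrixGrading (trivialGrading K) γ d) :
      ψ x ∈ grading K V d := by
    rw [mem_matrixGrading] at hx
    refine Submodule.sum_mem _ fun a _ => Submodule.sum_mem _ fun b _ => ?_
    rcases eq_or_ne (x a b) 0 with h | h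
    · rw [h, zero_smul]
      exact Submodule.zero_mem _
    · have hd : d = (p a).length - (p b).length := by
        have := hx a b h
        have := length_add_eq hγ (p a)
        have := length_add_eq hγ (p b)
        omega
      rw [hd]
      exact Submodule.smul_mem _ _ (path_mul_pathStar_mem_grading _ _)
  have hφ_mem {d : ℤ} {x : LeavittPathAlgebra K V} (hx : x ∈ grading K V d) :
      φ x ∈ matrixGrading (trivialGrading K) γ d := by
    have hle : grading K V d ≤
        (matrixGrading (trivialGrading K) γ d).comap (φ : LeavittPathAlgebra K V →ₗ[K] _) := by
      refine Submodule.span_le.2 ?_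
      rintro _ ⟨a, b, a', b', q, q', hd, rfl⟩
      change φ (path K q * pathStar K q') ∈ matrixGrading (trivialGrading K) γ d
      rw [map_mul, map_path_eq_single hφ, map_pathStar_eq_single hφ]
      rcases eq_or_ne b b' with rfl | hb
      · have hd' : d = γ a - γ a' := by
          have := length_add_eq hγ q
          have := length_add_eq hγ q'
          omega
        rw [Matrix.single_mul_single_same, hd']
        exact single_mem_matrixGrading _ _ _ _
      · rw [Matrix.single_mul_single_of_ne _ _ _ _ hb]
        exact Submodule.zero_mem _
    exact hle hx
  exact ⟨{ toFun := ψ, invFun := φ, left_inv := hφψ, right_inv := hψφ, map_mul' := hψ_mul,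
           map_add' := map_add ψ }, map_smul ψ,
    fun d x => ⟨hψ_mem, fun hx => by simpa [hφψ] using hφ_mem (x := ψ x) hx⟩⟩

end LeavittPathAlgebra

open LeavittPath LeavittPathAlgebra in
/-- A family of shifts with a unique minimum and without gaps is realized by the tree in which each
index other than that of the minimum emits one edge, to an index whose shift is smaller by one. -/
theorem IsTreeShift.exists_gradedAlgIsomorphic (K : Type u) [Field K] {n : ℕ} {γ : Fin n → ℤ}
    (h : IsTreeShift γ) :
    ∃ (V : Type v) (_ : Quiver.{w} V),
      IsFiniteGraph V ∧ IsAcyclicGraph V ∧ (∃! a : V, IsSink a) ∧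
      GradedAlgIsomorphic (matrixGrading (trivialGrading K) γ) (grading K V) := by
  obtain ⟨r, hr⟩ := h
  choose! lt parent hparent using hr
  let V := ULift.{v} (Fin n)
  let ht : V → ℤ := fun a => γ a.down
  -- An arrow is a proof that the target is the parent of the source, lifted to `Type w`.
  let : Quiver.{w} V := ⟨fun a b => ULift (PLift (a.down ≠ r ∧ b.down = parent a.down))⟩
  have hht (a b : V) (e : a ⟶ b) : ht a = ht b + 1 := by
    have : γ b.down = γ a.down - 1 := by rw [e.down.down.2, hparent _ e.down.down.1]
    change γ a.down = γ b.down + 1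
    omega
  have hs (a : V) : Subsingleton (Quiver.Star a) := by
    refine ⟨?_⟩
    rintro ⟨⟨b⟩, ⟨⟨hb⟩⟩⟩ ⟨⟨c⟩, ⟨⟨hc⟩⟩⟩
    obtain rfl : b = c := hb.2.trans hc.2.symm
    rfl
  have hr : IsSink (ULift.up r : V) := ⟨fun e => e.2.down.down.1 rfl⟩
  have hpath (m : ℕ) : ∀ a : V, ht a - γ r = m → Nonempty (Quiver.Path a (ULift.up r)) := by
    induction m with
    | zero =>
      rintro ⟨i⟩ hi
      obtain rfl : i = r := by
        by_contra hne
        have : γ i - γ r = 0 := hi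
        have := lt i hne
        omega
      exact ⟨.nil⟩
    | succ m ih =>
      rintro ⟨i⟩ hi
      have hi' : γ i - γ r = m + 1 := by exact_mod_cast hi
      have hne : i ≠ r := by
        rintro rfl
        omega
      have hp := hparent i hne
      obtain ⟨q⟩ := ih ⟨parent i⟩ (by change γ (parent i) - γ r = m; omega)
      let e : (ULift.up i : V) ⟶ ULift.up (parent i) := ⟨⟨hne, rfl⟩⟩
      exact ⟨e.toPath.comp q⟩
  have p (a : V) : Quiver.Path a (ULift.up r) := by
    refine Classical.choice (hpath (ht a - γ r).toNat a ?_)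
    rcases eq_or_ne a.down r with ha | ha
    · simp [ht, ha]
    · have := lt _ ha
      exact (Int.toNat_of_nonneg (by change 0 ≤ γ a.down - γ r; omega)).symm
  refine ⟨V, inferInstance, ⟨inferInstance, ?_⟩, ?_, ⟨ULift.up r, hr, ?_⟩, ?_⟩
  · refine Finite.of_injective (fun e : Quiver.Total V => e.left) ?_
    rintro ⟨a, b, e⟩ ⟨a', b', e'⟩ (rfl : a = a')
    cases (hs a).elim ⟨b, e⟩ ⟨b', e'⟩
    rfl
  · rintro a q ⟨hq, -⟩
    have := length_add_eq hht q
    omega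
  · rintro ⟨i⟩ hi
    by_contra hne
    have hne : i ≠ r := fun h => hne (by rw [h])
    exact hi.false ⟨⟨parent i⟩, ⟨⟨hne, rfl⟩⟩⟩
  · exact (gradedAlgIsomorphic_reindex Equiv.ulift.symm 0 fun i => by simp [ht]).trans
      (gradedAlgIsomorphic_of_tree hr hs p hht)

/-! ### Lists of shifts -/

theorem shiftList_zero (l : ℕ → ℕ) : shiftList 0 l = List.replicate (l 0) 0 := by
  simp [shiftList]

theorem shiftList_succ (k : ℕ) (l : ℕ → ℕ) :
    shiftList (k + 1) l = shiftList k l ++ List.replicate (l (k + 1)) ((k + 1 : ℕ) : ℤ) := by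
  rw [shiftList, List.range_succ, List.flatMap_append, List.flatMap_singleton, shiftList]

theorem mem_shiftList {k : ℕ} {l : ℕ → ℕ} {x : ℤ} :
    x ∈ shiftList k l ↔ ∃ i ≤ k, 0 < l i ∧ x = i := by
  simp [shiftList, List.mem_flatMap, List.mem_replicate, Nat.pos_iff_ne_zero]

theorem count_shiftList (k : ℕ) (l : ℕ → ℕ) (i : ℕ) :
    (shiftList k l).count (i : ℤ) = if i ≤ k then l i else 0 := by
  induction k with
  | zero => rcases i with _ | i <;> simp [shiftList_zero, List.count_replicate]; omega
  | succ k ih =>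
    rw [shiftList_succ, List.count_append, ih, List.count_replicate]
    rcases lt_trichotomy i (k + 1) with h | rfl | h
    · rw [if_pos (by omega), if_pos h.le, if_neg (by simp; omega), add_zero]
    · simp
    · simp [show ¬ i ≤ k by omega, show ¬ i ≤ k + 1 by omega]
      omega

theorem length_shiftList (k : ℕ) (l : ℕ → ℕ) :
    (shiftList k l).length = l 0 + ∑ i ∈ Finset.Icc 1 k, l i := by
  induction k with
  | zero => simp [shiftList_zero]
  | succ k ih =>
    rw [shiftList_succ, List.length_append, ih, List.length_replicate,
      Finset.sum_Icc_succ_top (by omega), add_assoc]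

theorem pairwise_shiftList (k : ℕ) (l : ℕ → ℕ) : (shiftList k l).Pairwise (· ≤ ·) := by
  induction k with
  | zero => simp [shiftList_zero, List.pairwise_replicate]
  | succ k ih =>
    rw [shiftList_succ, List.pairwise_append]
    refine ⟨ih, by simp [List.pairwise_replicate], fun x hx y hy => ?_⟩
    obtain ⟨i, hi, -, rfl⟩ := mem_shiftList.1 hx
    rw [List.eq_of_mem_replicate hy]
    exact_mod_cast hi.trans k.le_succ

theorem List.count_ofFn_eq_card {α : Type*} [DecidableEq α] {n : ℕ} (f : Fin n → α) (x : α) :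
    (List.ofFn f).count x = (Finset.univ.filter fun i => f i = x).card := by
  rw [← Multiset.coe_count, ← Fin.univ_val_map, Multiset.count_map]
  simp_rw [eq_comm (a := x)]
  rfl

theorem isTreeShift_of_perm_shiftList {n k : ℕ} {l : ℕ → ℕ} {δ : Fin n → ℤ}
    (h : (List.ofFn δ).Perm (shiftList k l)) (hl : ∀ i ∈ Finset.Icc 1 k, 0 < l i) (h0 : l 0 = 1) :
    IsTreeShift δ := by
  have hcount : (Finset.univ.filter fun i => δ i = 0).card = 1 := by
    rw [← List.count_ofFn_eq_card, h.count_eq]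
    simpa [h0] using count_shiftList k l 0
  obtain ⟨r, hr⟩ := Finset.card_eq_one.1 hcount
  have hr (i : Fin n) : δ i = 0 ↔ i = r := by simpa using Finset.ext_iff.1 hr i
  refine ⟨r, fun i hi => ?_⟩
  obtain ⟨a, ha, -, hia⟩ := mem_shiftList.1 (h.mem_iff.1 (List.mem_ofFn.2 ⟨i, rfl⟩))
  have h0i : δ i ≠ 0 := fun h => hi ((hr i).1 h)
  have hr0 := (hr r).2 rfl
  refine ⟨by omega, ?_⟩
  have hpos : 0 < l (a - 1) := by
    rcases Nat.eq_zero_or_pos (a - 1) with h1 | h1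
    · simp [h1, h0]
    · exact hl _ (Finset.mem_Icc.2 ⟨h1, by omega⟩)
  obtain ⟨j, hj⟩ := List.mem_ofFn.1 (h.mem_iff.2 (mem_shiftList.2 ⟨a - 1, by omega, hpos, rfl⟩))
  exact ⟨j, by omega⟩

theorem IsTreeShift.pos_and_eq_one {n k : ℕ} {l : ℕ → ℕ} {δ : Fin n → ℤ} (hδ : IsTreeShift δ)
    (h : (List.ofFn δ).Perm (shiftList k l)) (hzero : 0 ∈ Set.range δ)
    (hk : (k : ℤ) ∈ Set.range δ) : (∀ i ∈ Finset.Icc 1 k, 0 < l i) ∧ l 0 = 1 := by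
  obtain ⟨r, hr⟩ := hδ
  have hnonneg (i : Fin n) : 0 ≤ δ i := by
    obtain ⟨a, -, -, ha⟩ := mem_shiftList.1 (h.mem_iff.1 (List.mem_ofFn.2 ⟨i, rfl⟩))
    omega
  have hr0 (i : Fin n) : δ i = 0 ↔ i = r := by
    have hne (j) (hj : δ j = 0) : j = r := by
      by_contra hjr
      have := (hr j hjr).1
      have := hnonneg r
      omega
    obtain ⟨j, hj⟩ := hzero
    refine ⟨hne i, ?_⟩
    rintro rfl
    rwa [← hne j hj]
  have hcount (i : ℕ) (hi : i ≤ k) : (Finset.univ.filter fun j => δ j = i).card = l i := by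
    rw [← List.count_ofFn_eq_card, h.count_eq, count_shiftList, if_pos hi]
  constructor
  · have hdown (t : ℕ) : t ≤ k → ∃ j, δ j = (k : ℤ) - t := by
      induction t with
      | zero => simpa using hk
      | succ t ih =>
        intro ht
        obtain ⟨j, hj⟩ := ih (by omega)
        obtain ⟨j', hj'⟩ := (hr j fun hjr => by have := (hr0 j).2 hjr; omega).2
        exact ⟨j', by omega⟩
    intro i hi
    have hik := (Finset.mem_Icc.1 hi).2
    obtain ⟨j, hj⟩ := hdown (k - i) (by omega)
    rw [← hcount i hik, Finset.card_pos]
    exact ⟨j, Finset.mem_filter.2 ⟨Finset.mem_univ j, by omega⟩⟩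
  · rw [← hcount 0 k.zero_le, Finset.card_eq_one]
    exact ⟨r, by ext i; simp [hr0]⟩

theorem exists_isRepresentatives {n : ℕ} (hn : 0 < n) (γ : Fin n → ℤ) :
    ∃ k l, IsRepresentatives γ k l := by
  have : Nonempty (Fin n) := ⟨⟨0, hn⟩⟩
  obtain ⟨a, ha⟩ := Finite.exists_min γ
  obtain ⟨b, hb⟩ := Finite.exists_max γ
  refine ⟨(γ b - γ a).toNat, fun i => (Finset.univ.filter fun j => γ j - γ a = i).card, γ a,
    ⟨⟨a, rfl⟩, ?_⟩, ⟨⟨b, ?_⟩, ?_⟩, ?_⟩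
  · rintro _ ⟨i, rfl⟩
    exact ha i
  · have := ha b
    simp only
    omega
  · rintro _ ⟨i, rfl⟩
    have := ha b
    have := hb i
    simp only
    omega
  · refine List.Perm.eq_of_pairwise' (r := (· ≤ ·)) (List.pairwise_insertionSort _ _)
      (pairwise_shiftList _ _) ((List.perm_insertionSort _ _).trans ?_)
    refine List.perm_iff_count.2 fun x => ?_
    rw [List.count_ofFn_eq_card]
    rcases lt_or_ge x 0 with hx | hx
    · rw [List.count_eq_zero.2, Finset.card_eq_zero, Finset.filter_eq_empty_iff]
      · intro i _
        have := ha i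
        omega
      · rw [mem_shiftList]
        rintro ⟨i, -, -, rfl⟩
        omega
    · lift x to ℕ using hx
      rw [count_shiftList]
      split_ifs with hxk
      · rfl
      · rw [Finset.card_eq_zero, Finset.filter_eq_empty_iff]
        intro i _
        have := hb i
        omega

theorem IsTreeShift.of_isRepresentatives {n k : ℕ} {l : ℕ → ℕ} {γ : Fin n → ℤ}
    (hγ : IsTreeShift γ) (h : IsRepresentatives γ k l) :
    (∀ i ∈ Finset.Icc 1 k, 0 < l i) ∧ l 0 = 1 := by
  obtain ⟨m, ⟨⟨a, rfl⟩, -⟩, ⟨hk, -⟩, hsort⟩ := h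
  have hδ : IsTreeShift fun i => γ i - γ a := by
    obtain ⟨r, hr⟩ := hγ
    refine ⟨r, fun i hi => ?_⟩
    obtain ⟨h₁, j, hj⟩ := hr i hi
    exact ⟨sub_lt_sub_right h₁ _, j, by simp only [hj]; ring⟩
  exact hδ.pos_and_eq_one (hsort ▸ (List.perm_insertionSort _ _).symm) ⟨a, sub_self _⟩ hk

/-- If the representatives satisfy the numerical condition, sorting the shifts gives a list of the
normal form. -/
theorem exists_gradedAlgIsomorphic_shiftList (K : Type*) [Field K] {n : ℕ} (hn : 0 < n)
    {γ : Fin n → ℤ}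
    (h : ∀ k l, IsRepresentatives γ k l → (∀ i ∈ Finset.Icc 1 k, 0 < l i) ∧ l 0 = 1) :
    ∃ (k : ℕ) (l : ℕ → ℕ) (δ : Fin n → ℤ),
      l 0 = 1 ∧ (∀ i ∈ Finset.Icc 1 k, 0 < l i) ∧ n = 1 + ∑ i ∈ Finset.Icc 1 k, l i ∧
      List.ofFn δ = shiftList k l ∧
      GradedAlgIsomorphic (matrixGrading (trivialGrading K) γ)
        (matrixGrading (trivialGrading K) δ) := by
  obtain ⟨k, l, hkl⟩ := exists_isRepresentatives hn γ
  obtain ⟨hl, h0⟩ := h k l hkl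
  obtain ⟨m, -, -, hsort⟩ := hkl
  let f : Fin n → ℤ := fun i => γ i - m
  let σ := Tuple.sort f
  have hδ : List.ofFn (f ∘ σ) = shiftList k l := by
    rw [← hsort]
    exact List.Perm.eq_of_pairwise' (r := (· ≤ ·))
      (List.pairwise_ofFn.2 fun i j hij => Tuple.monotone_sort f hij.le)
      (List.pairwise_insertionSort _ _)
      ((σ.ofFn_comp_perm f).trans (List.perm_insertionSort _ _).symm)
  refine ⟨k, l, f ∘ σ, h0, hl, ?_, hδ, gradedAlgIsomorphic_reindex σ.symm m fun i => ?_⟩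
  · have := length_shiftList k l
    rwa [h0, ← hδ, List.length_ofFn] at this
  · simp [f]

/-! ### The equivalence -/

theorem proposition3p2 {K : Type u} [Field K] (n : ℕ) (hn : 0 < n) (γ : Fin n → ℤ) :
    -- with graded ring isomorphisms
    List.TFAE [
      -- (1) `R` is graded isomorphic to a Leavitt path algebra
      ∃ (V : Type v) (_ : Quiver.{w} V),
        GradedRingIsomorphic (matrixGrading (trivialGrading K) γ) (LeavittPathAlgebra.grading K V),
      -- (2) the graph can be taken finite and acyclic with a unique sink
      ∃ (V : Type v) (_ : Quiver.{w} V),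
        LeavittPath.IsFiniteGraph V ∧ LeavittPath.IsAcyclicGraph V ∧
        (∃! a : V, LeavittPath.IsSink a) ∧
        GradedRingIsomorphic (matrixGrading (trivialGrading K) γ) (LeavittPathAlgebra.grading K V),
      -- (3) `R` is graded isomorphic to `𝕄ₙ(K)(0, l₁(1), …, lₖ(k))` with positive `l₁, …, lₖ`
      ∃ (k : ℕ) (l : ℕ → ℕ) (δ : Fin n → ℤ),
        l 0 = 1 ∧ (∀ i ∈ Finset.Icc 1 k, 0 < l i) ∧ n = 1 + ∑ i ∈ Finset.Icc 1 k, l i ∧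
        List.ofFn δ = shiftList k l ∧
        GradedRingIsomorphic (matrixGrading (trivialGrading K) γ)
          (matrixGrading (trivialGrading K) δ),
      -- (4) the representatives of `R` satisfy `l₀ = 1` and `lᵢ > 0` for `i = 1, …, k`
      ∀ (k : ℕ) (l : ℕ → ℕ), IsRepresentatives γ k l →
        (∀ i ∈ Finset.Icc 1 k, 0 < l i) ∧ l 0 = 1] ∧
    -- the same four conditions, with graded `K`-algebra isomorphisms
    List.TFAE [
      ∃ (V : Type v) (_ : Quiver.{w} V),
        GradedAlgIsomorphic (matrixGrading (trivialGrading K) γ) (LeavittPathAlgebra.grading K V),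
      ∃ (V : Type v) (_ : Quiver.{w} V),
        LeavittPath.IsFiniteGraph V ∧ LeavittPath.IsAcyclicGraph V ∧
        (∃! a : V, LeavittPath.IsSink a) ∧
        GradedAlgIsomorphic (matrixGrading (trivialGrading K) γ) (LeavittPathAlgebra.grading K V),
      ∃ (k : ℕ) (l : ℕ → ℕ) (δ : Fin n → ℤ),
        l 0 = 1 ∧ (∀ i ∈ Finset.Icc 1 k, 0 < l i) ∧ n = 1 + ∑ i ∈ Finset.Icc 1 k, l i ∧
        List.ofFn δ = shiftList k l ∧
        GradedAlgIsomorphic (matrixGrading (trivialGrading K) γ)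
          (matrixGrading (trivialGrading K) δ),
      ∀ (k : ℕ) (l : ℕ → ℕ), IsRepresentatives γ k l →
        (∀ i ∈ Finset.Icc 1 k, 0 < l i) ∧ l 0 = 1] := by

  have tree_of_matrix {k : ℕ} {l : ℕ → ℕ} {δ : Fin n → ℤ} (h0 : l 0 = 1)
      (hl : ∀ i ∈ Finset.Icc 1 k, 0 < l i) (hδ : List.ofFn δ = shiftList k l) :=
    (isTreeShift_of_perm_shiftList (.of_eq hδ) hl h0).exists_gradedAlgIsomorphic.{u, v, w} K
  constructor
  · tfae_have 2 → 1 := fun ⟨V, q, _, _, _, h⟩ => ⟨V, q, h⟩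
    tfae_have 1 → 4 := fun ⟨_, _, h⟩ _ _ hkl => (h.isTreeShift hn).of_isRepresentatives hkl
    tfae_have 4 → 3 := fun h =>
      let ⟨k, l, δ, h0, hl, hsum, hδ, hiso⟩ := exists_gradedAlgIsomorphic_shiftList K hn h
      ⟨k, l, δ, h0, hl, hsum, hδ, hiso.gradedRingIsomorphic⟩
    tfae_have 3 → 2 := fun ⟨_, _, _, h0, hl, _, hδ, hiso⟩ =>
      let ⟨V, q, hfin, hacyc, hsink, hiso'⟩ := tree_of_matrix h0 hl hδ
      ⟨V, q, hfin, hacyc, hsink, hiso.trans hiso'.gradedRingIsomorphic⟩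
    tfae_finish
  · tfae_have 2 → 1 := fun ⟨V, q, _, _, _, h⟩ => ⟨V, q, h⟩
    tfae_have 1 → 4 := fun ⟨_, _, h⟩ _ _ hkl =>
      (h.gradedRingIsomorphic.isTreeShift hn).of_isRepresentatives hkl
    tfae_have 4 → 3 := fun h => exists_gradedAlgIsomorphic_shiftList K hn h
    tfae_have 3 → 2 := fun ⟨_, _, _, h0, hl, _, hδ, hiso⟩ =>
      let ⟨V, q, hfin, hacyc, hsink, hiso'⟩ := tree_of_matrix h0 hl hδ
      ⟨V, q, hfin, hacyc, hsink, hiso.trans hiso'⟩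
    tfae_finish
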